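/- For $n\in\mathbb N$ let $\Omega_n=\{0,1\}^n$ with uniform measure $\mu$. For $\mathcal A,\mathcal B\subset\Omega_n$ put $I_k(\mathcal A)=2\mu(\{x\in\mathcal A: x\oplus e_k\notin\mathcal A\})$, $\mathcal W_1(\mathcal A,\mathcal B)=\sum_{i=1}^n I_i(\mathcal A)I_i(\mathcal B)$, $\mathrm{Cov}(\mathcal A,\mathcal B)=\mu(\mathcal A\cap\mathcal B)-\mu(\mathcal A)\mu(\mathcal B)$ and $\varphi(x)=x/\log(e/x)$. Talagrand's bound states that $\mathrm{Cov}(\mathcal A,\mathcal B)\ge c\,\varphi(\mathcal W_1(\mathcal A,\mathcal B))$ for increasing $\mathcal A,\mathcal B$ and a universal $c>0$. An (increasing) Hamming ball is a family $\{x:\sum_i x_i>t\}$ with $t\in\mathbb R$; the dual of $\mathcal A$ is $\{x:\bar x\notin\mathcal A\}$, where $\bar x=(1-x_1,\dots,1-x_n)$. Say that a pair of families is tight with constant $K$ if both families are increasing, $\mathrm{Cov}\le K\varphi(\mathcal W_1)$ and $\varphi(\mathcal W_1)\le K\,\mathrm{Cov}$. **Proposition.** There are universal constants $a_0>0$ and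 $K>0$ such that the following holds for every $0<a<a_0$. There exist Hamming balls $\mathcal A_n\subset\Omega_n$ with $\mu(\mathcal A_n)\to a$ and Hamming balls $\mathcal B'_n\subset\Omega_{n+1}$ with $\mu(\mathcal B'_n)\to 1-a$ as $n\to\infty$. Let $(\mathcal A_n)$ be any sequence of Hamming balls $\mathcal A_n\subset\Omega_n$ with $\mu(\mathcal A_n)\to a$, and let $\mathcal B_n$ be the dual of $\mathcal A_n$. (a) Let $\mathcal B'_n\subset\Omega_{n+1}$ be any Hamming balls with $\mu(\mathcal B'_n)\to 1-a$, and let $\mathcal A'_n=\{(x_1,\dots,x_n,y): x\in\mathcal A_n\ \vee\ y=1\}\subset\Omega_{n+1}$. Then $(\mathcal A'_n,\mathcal B'_n)$ is tight with constant $K$ for all sufficiently large $n$. (b) There exist $\ell=\ell(n)$ and Hamming balls $\mathcal C_n\subset\Omega_{\ell(n)}$ with $\mu(\mathcal C_n)=1/2$ such that $I_i(\mathcal C_n)/I_j(\mathcal B_n)\to1$ as $n\to\infty$, uniformly in $i,j$. For every such choice, with $$\mathcal A'_n=\{(x,y)\in\Omega_{n+\ell}: x\in\mathcal A_n\ \vee\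 y_1=1\},\qquad \mathcal B'_n=\{(x,y)\in\Omega_{n+\ell}: x\in\mathcal B_n\ \wedge\ y\in\mathcal C_n\},$$ the pair $(\mathcal A'_n,\mathcal B'_n)$ is tight with constant $K$ for all sufficiently large $n$. -/

import Mathlib

open Filter Topology

namespace DiscreteCube

/-- The discrete cube `{0,1}^n`, ordered coordinatewise (`false ≤ true`). -/
abbrev Cube (n : ℕ) : Type := Fin n → Bool

/-- The uniform probability measure of a family `A ⊆ {0,1}^n`. -/
noncomputable def mu {n : ℕ} (A : Finset (Cube n)) : ℝ := (A.card : ℝ) / 2 ^ n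

/-- `x ⊕ e_k`: the point `x` with its `k`-th coordinate flipped. -/
def flip {n : ℕ} (x : Cube n) (k : Fin n) : Cube n := Function.update x k (!(x k))

/-- The influence of the `k`-th variable on `A`: `2 μ {x ∈ A | x ⊕ e_k ∉ A}`. -/
noncomputable def influence {n : ℕ} (A : Finset (Cube n)) (k : Fin n) : ℝ :=
  2 * mu (A.filter fun x => flip x k ∉ A)

/-- `W₁(A,B) = ∑ i, I_i(A) I_i(B)`. -/
noncomputable def W1 {n : ℕ} (A B : Finset (Cube n)) : ℝ :=
  ∑ i : Fin n, influence A i * influence B i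

/-- `Cov(A,B) = μ(A ∩ B) - μ(A) μ(B)`. -/
noncomputable def cov {n : ℕ} (A B : Finset (Cube n)) : ℝ := mu (A ∩ B) - mu A * mu B

/-- `φ(x) = x / log(e/x)`. -/
noncomputable def phi (x : ℝ) : ℝ := x / Real.log (Real.exp 1 / x)

/-- A family is increasing if it is closed under passing to coordinatewise larger points. -/
def Increasing {n : ℕ} (A : Finset (Cube n)) : Prop := IsUpperSet (A : Set (Cube n))

/-- The pair `(A,B)` of increasing families attains Talagrand's lower bound
`Cov(A,B) ≥ c φ(W₁(A,B))` up to the factor `K` (in both directions). -/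
def TightWith (K : ℝ) {n : ℕ} (A B : Finset (Cube n)) : Prop :=
  Increasing A ∧ Increasing B ∧ cov A B ≤ K * phi (W1 A B) ∧ phi (W1 A B) ≤ K * cov A B

/-- An increasing Hamming ball: a family of the form `{x | ∑ x_i > t}`. -/
def IsHammingBall {n : ℕ} (A : Finset (Cube n)) : Prop :=
  ∃ t : ℝ, ∀ x : Cube n, x ∈ A ↔ t < ∑ i : Fin n, if x i = true then (1 : ℝ) else 0

/-- The dual family: `x` belongs to it iff the complement `x̄` does not belong to `A`. -/
def dual {n : ℕ} (A : Finset (Cube n)) : Finset (Cube n) :=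
  Finset.univ.filter fun x => (fun i => !(x i)) ∉ A

/-- `F n = m_a(x_1, …, x_{k n})`: increasing Hamming balls in the cubes `{0,1}^{k n}` whose measure
is `a`. In each dimension only finitely many measures of balls occur, so this is understood
asymptotically: the measures tend to `a` as `n → ∞`. -/
def IsBallSeq (k : ℕ → ℕ) (a : ℝ) (F : ∀ n, Finset (Cube (k n))) : Prop :=
  (∀ n, IsHammingBall (F n)) ∧ Tendsto (fun n => mu (F n)) atTop (𝓝 a)

/-- `C n = m_{1/2}(y_1, …, y_{ℓ n})` is an exactly balanced increasing Hamming ball, and `ℓ n` is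
such that `I_i(C n) ∼ I_j(B n)` for all `i, j` (asymptotic equality, uniformly in `i, j`). -/
def IsMatchingBalanced (B : ∀ n, Finset (Cube n)) (l : ℕ → ℕ) (C : ∀ n, Finset (Cube (l n))) :
    Prop :=
  (∀ n, IsHammingBall (C n) ∧ mu (C n) = 1 / 2) ∧
    ∀ ε : ℝ, 0 < ε → ∀ᶠ n in atTop, ∀ (i : Fin (l n)) (j : Fin n),
      |influence (C n) i - influence (B n) j| ≤ ε * influence (B n) j

/-- `{(x_1, …, x_n, y_1, …, y_l) | x ∈ A ∨ y_1 = 1}`. -/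
def orFirst {n : ℕ} (A : Finset (Cube n)) (l : ℕ) : Finset (Cube (n + l)) :=
  Finset.univ.filter fun z =>
    (fun i : Fin n => z (Fin.castAdd l i)) ∈ A ∨
      ∃ j : Fin l, j.val = 0 ∧ z (Fin.natAdd n j) = true

/-- `{(x_1, …, x_n, y_1, …, y_l) | x ∈ B ∧ y ∈ C}`. -/
def andFamily {n l : ℕ} (B : Finset (Cube n)) (C : Finset (Cube l)) : Finset (Cube (n + l)) :=
  Finset.univ.filter fun z =>
    (fun i : Fin n => z (Fin.castAdd l i)) ∈ B ∧ (fun j : Fin l => z (Fin.natAdd n j)) ∈ C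

end DiscreteCube

namespace DiscreteCube

/-! ### Sums over the cube -/

/-! Write `L = log (1/a)`. Everything rests on the estimate `n I² ≍ a² L` for the common influence
`I` of a ball of measure about `a` (`IsHammingBall.influence_bounds`). The bridge is that the total
of `signSum` over an increasing family is half the sum of its influences, times `2 ^ n`. The upper
bound is the level-one inequality, by exponential moments. For the lower bound, independent blocks
show that `signSum` exceeds a level of order `√(nL)` with probability above `2a`; the threshold of
the ball is therefore at least that high, and so is the mean of `signSum` on the ball.

In both constructions `W1` then reduces to a sum over the `x`-coordinates, of order `a² L`, plus a
term bounded by the influence `J` of the coordinate `y₁`, which tends to zero. Since `log (e / (a²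
L)) ≍ L`, `phi` turns this into `a²` (`phi_bounds`). The covariance has a closed form, a multiple of
`a²` up to the choice of measures plus a multiple of `J` (`cov_orFirst_one`,
`cov_orFirst_andFamily`), so it is of order `a²` too.

Balls of prescribed limiting measure exist because consecutive balls differ by an influence in one
dimension higher, which is `O(n^(-1/2))`. Matching balanced balls are majorities in odd dimension,
whose influences decrease slowly enough to approximate every small value to relative accuracy
tending to zero. -/

/-- The number of ones of `x`, as a real number. -/
noncomputable def weight {n : ℕ} (x : Cube n) : ℝ := ∑ i : Fin n, if x i = true then (1 : ℝ) else 0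

/-- The sum of the coordinates of `x` in the `±1` encoding. -/
noncomputable def signSum {n : ℕ} (x : Cube n) : ℝ :=
  ∑ i : Fin n, if x i = true then (1 : ℝ) else -1

lemma signSum_eq {n : ℕ} (x : Cube n) : signSum x = 2 * weight x - n := by
  have : ∀ i : Fin n, (if x i = true then (1 : ℝ) else -1)
      = 2 * (if x i = true then (1 : ℝ) else 0) - 1 := by
    intro i; split_ifs <;> norm_num
  simp only [signSum, weight, this, Finset.sum_sub_distrib, Finset.mul_sum]
  simp

lemma sum_cube_succ {n : ℕ} (f : Cube (n + 1) → ℝ) :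
    ∑ x, f x = ∑ x : Cube n, (f (Fin.cons true x) + f (Fin.cons false x)) := by
  rw [← (Fin.consEquiv fun _ : Fin (n + 1) => Bool).sum_comp, Fintype.sum_prod_type,
    Fintype.sum_bool, Finset.sum_add_distrib]
  rfl

lemma sum_cube_add {n l : ℕ} (f : Cube (n + l) → ℝ) :
    ∑ z, f z = ∑ x : Cube n, ∑ y : Cube l, f (Fin.append x y) := by
  rw [← (Fin.appendEquiv (α := Bool) n l).sum_comp, Fintype.sum_prod_type]
  rfl

lemma weight_cons {n : ℕ} (b : Bool) (x : Cube n) :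
    weight (Fin.cons b x : Cube (n + 1)) = (if b = true then 1 else 0) + weight x := by
  simp only [weight, Fin.sum_univ_succ, Fin.cons_zero, Fin.cons_succ]

lemma signSum_cons {n : ℕ} (b : Bool) (x : Cube n) :
    signSum (Fin.cons b x : Cube (n + 1)) = (if b = true then 1 else -1) + signSum x := by
  simp [signSum, Fin.sum_univ_succ]

lemma weight_append {n l : ℕ} (x : Cube n) (y : Cube l) :
    weight (Fin.append x y) = weight x + weight y := by
  simp only [weight, Fin.sum_univ_add, Fin.append_left, Fin.append_right]

lemma signSum_append {n l : ℕ} (x : Cube n) (y : Cube l) :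
    signSum (Fin.append x y) = signSum x + signSum y := by
  simp [signSum, Fin.sum_univ_add]

lemma weight_not {n : ℕ} (x : Cube n) : weight (fun i => !(x i)) = n - weight x := by
  have : ∀ i : Fin n, (if (!(x i)) = true then (1 : ℝ) else 0)
      = 1 - (if x i = true then (1 : ℝ) else 0) := by
    intro i; cases x i <;> simp
  simp only [weight, this, Finset.sum_sub_distrib]
  simp

lemma signSum_not {n : ℕ} (x : Cube n) : signSum (fun i => !(x i)) = -signSum x := by
  rw [signSum_eq, signSum_eq, weight_not]; ring

lemma sum_signSum_sq (n : ℕ) : ∑ x : Cube n, signSum x ^ 2 = n * 2 ^ n := by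
  induction n with
  | zero => simp [signSum]
  | succ n ih =>
    have h : ∀ x : Cube n, (1 + signSum x) ^ 2 + (-1 + signSum x) ^ 2 = 2 * signSum x ^ 2 + 2 := by
      intro x; ring
    simp only [sum_cube_succ, signSum_cons, if_true, Bool.false_eq_true, if_false, h,
      Finset.sum_add_distrib, ← Finset.mul_sum, ih]
    simp; ring

lemma sum_signSum_pow_four_le (n : ℕ) : ∑ x : Cube n, signSum x ^ 4 ≤ 3 * n ^ 2 * 2 ^ n := by
  induction n with
  | zero => simp [signSum]
  | succ n ih =>
    have h : ∀ x : Cube n, (1 + signSum x) ^ 4 + (-1 + signSum x) ^ 4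
        = 2 * signSum x ^ 4 + 12 * signSum x ^ 2 + 2 := by
      intro x; ring
    simp only [sum_cube_succ, signSum_cons, if_true, Bool.false_eq_true, if_false, h,
      Finset.sum_add_distrib, ← Finset.mul_sum, sum_signSum_sq]
    simp only [Finset.sum_const, Finset.card_univ, Fintype.card_pi, Fintype.card_bool,
      Finset.prod_const, Fintype.card_fin, nsmul_eq_mul, Nat.cast_pow, Nat.cast_ofNat]
    push_cast
    rw [pow_succ (2 : ℝ) n]
    have : (0 : ℝ) < 2 ^ n := by positivity
    nlinarith

lemma sum_exp_signSum (n : ℕ) (s : ℝ) :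
    ∑ x : Cube n, Real.exp (s * signSum x) = 2 ^ n * Real.cosh s ^ n := by
  induction n with
  | zero => simp [signSum]
  | succ n ih =>
    have h : ∀ x : Cube n, Real.exp (s * (1 + signSum x)) + Real.exp (s * (-1 + signSum x))
        = 2 * Real.cosh s * Real.exp (s * signSum x) := by
      intro x
      rw [mul_add, mul_add, Real.exp_add, Real.exp_add, Real.cosh_eq]; ring_nf
    simp only [sum_cube_succ, signSum_cons, if_true, Bool.false_eq_true, if_false, h,
      ← Finset.mul_sum, ih]
    ring

/-! ### The uniform measure -/

lemma mu_eq_sum {n : ℕ} (A : Finset (Cube n)) :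
    mu A = (∑ x : Cube n, if x ∈ A then (1 : ℝ) else 0) / 2 ^ n := by
  simp [mu]

lemma card_eq_mu {n : ℕ} (A : Finset (Cube n)) : (A.card : ℝ) = 2 ^ n * mu A := by
  unfold mu; field_simp

lemma mu_nonneg {n : ℕ} (A : Finset (Cube n)) : 0 ≤ mu A := by unfold mu; positivity

lemma mu_mono {n : ℕ} {A B : Finset (Cube n)} (h : A ⊆ B) : mu A ≤ mu B := by
  unfold mu
  gcongr

lemma mu_univ (n : ℕ) : mu (Finset.univ : Finset (Cube n)) = 1 := by
  simp [mu]

lemma mu_empty (n : ℕ) : mu (∅ : Finset (Cube n)) = 0 := by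
  simp [mu]

lemma mu_le_one {n : ℕ} (A : Finset (Cube n)) : mu A ≤ 1 := by
  rw [← mu_univ n]; exact mu_mono (Finset.subset_univ A)

lemma mu_union {n : ℕ} {A B : Finset (Cube n)} (h : Disjoint A B) :
    mu (A ∪ B) = mu A + mu B := by
  simp [mu, Finset.card_union_of_disjoint h, add_div]

lemma mu_filter_add {n : ℕ} (A : Finset (Cube n)) (p : Cube n → Prop) [DecidablePred p] :
    mu (A.filter p) + mu (A.filter fun x => ¬ p x) = mu A := by
  unfold mu
  rw [← add_div, ← Nat.cast_add, Finset.card_filter_add_card_filter_not]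

lemma mu_compl {n : ℕ} (A : Finset (Cube n)) : mu Aᶜ = 1 - mu A := by
  have := mu_union (disjoint_compl_right (a := A))
  rw [Finset.union_compl, mu_univ] at this
  linarith

lemma mu_congr {n : ℕ} {A B : Finset (Cube n)} (f : Cube n → Cube n)
    (hA : ∀ x ∈ A, f x ∈ B) (hB : ∀ x ∈ B, f x ∈ A) (hf : ∀ x, f (f x) = x) : mu A = mu B := by
  unfold mu
  rw [Finset.card_nbij' (t := B) f f hA hB (fun x _ => hf x) (fun x _ => hf x)]

lemma mem_andFamily_append {n l : ℕ} {B : Finset (Cube n)} {C : Finset (Cube l)} (x : Cube n)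
    (y : Cube l) : Fin.append x y ∈ andFamily B C ↔ x ∈ B ∧ y ∈ C := by
  simp [andFamily]

lemma mu_andFamily {n l : ℕ} (B : Finset (Cube n)) (C : Finset (Cube l)) :
    mu (andFamily B C) = mu B * mu C := by
  have h : ∀ (x : Cube n) (y : Cube l), (if x ∈ B ∧ y ∈ C then (1 : ℝ) else 0)
      = (if x ∈ B then 1 else 0) * (if y ∈ C then 1 else 0) := by
    intro x y; by_cases hx : x ∈ B <;> by_cases hy : y ∈ C <;> simp [hx, hy]
  simp only [mu_eq_sum, sum_cube_add, mem_andFamily_append, h, ← Finset.mul_sum, ← Finset.sum_mul]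
  rw [pow_add]; field_simp

lemma append_surjective {n l : ℕ} (z : Cube (n + l)) :
    ∃ (x : Cube n) (y : Cube l), Fin.append x y = z :=
  ⟨_, _, Fin.append_castAdd_natAdd⟩

lemma ext_append {n l : ℕ} {F G : Finset (Cube (n + l))}
    (h : ∀ (x : Cube n) (y : Cube l), Fin.append x y ∈ F ↔ Fin.append x y ∈ G) : F = G := by
  ext z
  obtain ⟨x, y, rfl⟩ := append_surjective z
  exact h x y

/-! ### Flips and influences -/

lemma flip_flip {n : ℕ} (x : Cube n) (k : Fin n) : flip (flip x k) k = x := by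
  simp [flip]

lemma flip_same {n : ℕ} (x : Cube n) (k : Fin n) : flip x k k = !(x k) := by simp [flip]

lemma flip_append_castAdd {n l : ℕ} (x : Cube n) (y : Cube l) (i : Fin n) :
    flip (Fin.append x y) (Fin.castAdd l i) = Fin.append (flip x i) y := by
  ext j
  refine Fin.addCases (fun j => ?_) (fun j => ?_) j
  · simp [flip, Function.update_apply]
  · have : Fin.natAdd n j ≠ Fin.castAdd l i := by
      intro h; have := congrArg Fin.val h; simp at this; omega
    simp [flip, this]

lemma flip_append_natAdd {n l : ℕ} (x : Cube n) (y : Cube l) (i : Fin l) :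
    flip (Fin.append x y) (Fin.natAdd n i) = Fin.append x (flip y i) := by
  ext j
  refine Fin.addCases (fun j => ?_) (fun j => ?_) j
  · have : Fin.castAdd l j ≠ Fin.natAdd n i := by
      intro h; have := congrArg Fin.val h; simp at this; omega
    simp [flip, this]
  · simp [flip, Function.update_apply]

lemma influence_nonneg {n : ℕ} (A : Finset (Cube n)) (k : Fin n) : 0 ≤ influence A k :=
  mul_nonneg zero_le_two (mu_nonneg _)

lemma le_flip {n : ℕ} (x : Cube n) (k : Fin n) (h : x k = false) : x ≤ flip x k := by
  intro i
  by_cases hi : i = k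
  · subst hi; simp [h]
  · simp [flip, hi]

/-- By monotonicity every pivotal point of `A` has `x k = true`; the non-pivotal points with `x k =
true` are matched by the flip with the points of `A` having `x k = false`. -/
lemma mu_filter_true_sub {n : ℕ} {A : Finset (Cube n)} (hA : Increasing A) (k : Fin n) :
    mu (A.filter fun x => x k = true) - mu (A.filter fun x => ¬ x k = true) = influence A k / 2 := by
  have h1 := mu_filter_add (A.filter fun x => x k = true) (fun x => flip x k ∉ A)
  rw [Finset.filter_filter, Finset.filter_filter] at h1
  have h2 : (A.filter fun x => x k = true ∧ flip x k ∉ A) = A.filter fun x => flip x k ∉ A := by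
    ext x
    simp only [Finset.mem_filter]
    refine ⟨fun h => ⟨h.1, h.2.2⟩, fun h => ⟨h.1, ?_, h.2⟩⟩
    by_contra hx
    exact h.2 (hA (le_flip x k (by simpa using hx)) h.1)
  have h3 : mu (A.filter fun x => x k = true ∧ ¬ flip x k ∉ A)
      = mu (A.filter fun x => ¬ x k = true) := by
    refine mu_congr (fun x => flip x k) ?_ ?_ (fun x => flip_flip x k)
    · intro x hx
      simp only [Finset.mem_filter, not_not] at hx ⊢
      exact ⟨hx.2.2, by simp [flip_same, hx.2.1]⟩
    · intro x hx
      simp only [Finset.mem_filter, not_not] at hx ⊢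
      have hk : x k = false := by simpa using hx.2
      exact ⟨hA (le_flip x k hk) hx.1, by simp [flip_same, hk], by rw [flip_flip]; exact hx.1⟩
  rw [h2, h3] at h1
  unfold influence
  linarith

lemma mu_filter_true {n : ℕ} {A : Finset (Cube n)} (hA : Increasing A) (k : Fin n) :
    mu (A.filter fun x => x k = true) = mu A / 2 + influence A k / 4 := by
  have h1 := mu_filter_true_sub hA k
  have h2 := mu_filter_add A (fun x => x k = true)
  linarith

lemma mu_filter_not_true {n : ℕ} {A : Finset (Cube n)} (hA : Increasing A) (k : Fin n) :
    mu (A.filter fun x => ¬ x k = true) = mu A / 2 - influence A k / 4 := by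
  have h1 := mu_filter_true_sub hA k
  have h2 := mu_filter_add A (fun x => x k = true)
  linarith

lemma mu_coord {n : ℕ} (k : Fin n) :
    mu (Finset.univ.filter fun x : Cube n => x k = true) = 1 / 2 := by
  have h : Increasing (Finset.univ : Finset (Cube n)) := fun x y _ _ => by simp
  rw [mu_filter_true h k, mu_univ]
  simp [influence, mu_empty]

lemma mu_not_coord {n : ℕ} (k : Fin n) :
    mu (Finset.univ.filter fun x : Cube n => ¬ x k = true) = 1 / 2 := by
  have h2 := mu_filter_add Finset.univ (fun x : Cube n => x k = true)
  rw [mu_coord, mu_univ] at h2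
  linarith

lemma sum_signSum {n : ℕ} {A : Finset (Cube n)} (hA : Increasing A) :
    ∑ x ∈ A, signSum x = 2 ^ n * ((∑ k, influence A k) / 2) := by
  unfold signSum
  rw [Finset.sum_comm, Finset.sum_div, Finset.mul_sum]
  refine Finset.sum_congr rfl fun k _ => ?_
  rw [← mu_filter_true_sub hA k, Finset.sum_ite, mul_sub, ← card_eq_mu, ← card_eq_mu]
  simp [sub_eq_add_neg]

lemma mu_dual {n : ℕ} (A : Finset (Cube n)) : mu (dual A) = 1 - mu A := by
  rw [← mu_compl]
  refine mu_congr (fun x i => !(x i)) ?_ ?_ (fun x => by simp) <;> intro x hx <;>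
    simpa [dual] using hx

lemma influence_dual {n : ℕ} (A : Finset (Cube n)) (k : Fin n) :
    influence (dual A) k = influence A k := by
  unfold influence
  congr 1
  have key : ∀ x : Cube n, (fun i => !(flip x k i)) = flip (fun i => !(x i)) k := by
    intro x; ext i
    by_cases hi : i = k
    · subst hi; simp [flip]
    · simp [flip, hi]
  -- Complementing exchanges the inner and outer ends of a pivotal edge, so a further flip is needed
  -- to return to the inner end.
  refine mu_congr (fun x => flip (fun i => !(x i)) k) ?_ ?_ ?_
  · intro x hx
    simp only [dual, Finset.mem_filter, Finset.mem_univ, true_and, key, not_not] at hx ⊢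
    rw [flip_flip]
    exact ⟨hx.2, hx.1⟩
  · intro x hx
    simp only [dual, Finset.mem_filter, Finset.mem_univ, true_and, key, not_not] at hx ⊢
    simp only [Bool.not_not, flip_flip]
    exact ⟨hx.2, hx.1⟩
  · intro x
    simp only [key, Bool.not_not, flip_flip]

/-! ### Hamming balls -/

lemma weight_mono {n : ℕ} {x y : Cube n} (h : x ≤ y) : weight x ≤ weight y := by
  refine Finset.sum_le_sum fun i _ => ?_
  have := h i
  split_ifs with h1 h2
  · exact le_rfl
  · exact absurd (this h1) h2
  · exact zero_le_one
  · exact le_rfl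

lemma weight_comp_equiv {n : ℕ} (x : Cube n) (e : Equiv.Perm (Fin n)) :
    weight (fun i => x (e i)) = weight x :=
  Equiv.sum_comp e fun i => if x i = true then (1 : ℝ) else 0

lemma IsHammingBall.exists_weight {n : ℕ} {A : Finset (Cube n)} (h : IsHammingBall A) :
    ∃ t : ℝ, ∀ x, x ∈ A ↔ t < weight x := h

lemma IsHammingBall.increasing {n : ℕ} {A : Finset (Cube n)} (h : IsHammingBall A) :
    Increasing A := by
  obtain ⟨t, ht⟩ := h.exists_weight
  intro x y hxy hx
  rw [Finset.mem_coe, ht] at *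
  exact hx.trans_le (weight_mono hxy)

lemma IsHammingBall.dual {n : ℕ} {A : Finset (Cube n)} (h : IsHammingBall A) :
    IsHammingBall (dual A) := by
  obtain ⟨t, ht⟩ := h.exists_weight
  -- Duality turns the strict threshold into a non-strict one; integrality of the weight restores
  -- strictness.
  obtain ⟨s, hs⟩ : ∃ s : ℝ, ∀ j : ℕ, s < (j : ℝ) ↔ (n : ℝ) - t ≤ j := by
    refine ⟨(⌈(n : ℝ) - t⌉ : ℝ) - 1, fun j => ?_⟩
    have h := Int.ceil_le (z := (j : ℤ)) (a := (n : ℝ) - t)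
    rw [Int.cast_natCast] at h
    rw [← h, ← Int.cast_natCast (R := ℝ) j, ← Int.cast_one, ← Int.cast_sub, Int.cast_lt]
    omega
  refine ⟨s, fun x => ?_⟩
  have hw : ((Finset.univ.filter fun i => x i = true).card : ℝ) = weight x := by
    simp [weight]
  change _ ↔ s < weight x
  rw [← hw, hs, hw]
  simp only [DiscreteCube.dual, Finset.mem_filter, Finset.mem_univ, true_and, ht, weight_not,
    not_lt]
  constructor <;> intro h <;> linarith

/-- Balls are invariant under transpositions of coordinates. -/
lemma IsHammingBall.influence_eq {n : ℕ} {A : Finset (Cube n)} (h : IsHammingBall A)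
    (i j : Fin n) : influence A i = influence A j := by
  obtain ⟨t, ht⟩ := h.exists_weight
  unfold influence
  congr 1
  have key : ∀ (i j : Fin n) (x : Cube n),
      flip (fun m => x (Equiv.swap i j m)) j = fun m => flip x i (Equiv.swap i j m) := by
    intro i j x
    ext m
    by_cases hm : m = j
    · subst hm; simp [flip]
    · have : Equiv.swap i j m ≠ i := by
        rw [Ne, Equiv.swap_apply_eq_iff]; simpa using hm
      simp [flip, hm, this]
  have main : ∀ i j : Fin n, ∀ x ∈ A.filter fun x => flip x i ∉ A,
      (fun m => x (Equiv.swap i j m)) ∈ A.filter fun x => flip x j ∉ A := by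
    intro i j x hx
    simp only [Finset.mem_filter, ht, key, weight_comp_equiv] at hx ⊢
    exact hx
  refine mu_congr (fun x m => x (Equiv.swap i j m)) (main i j) ?_ (fun x => by simp)
  rw [Equiv.swap_comm]
  exact main j i

lemma IsHammingBall.sum_signSum {n : ℕ} {A : Finset (Cube n)} (h : IsHammingBall A) (k : Fin n) :
    ∑ x ∈ A, signSum x = 2 ^ n * (n * influence A k / 2) := by
  rw [DiscreteCube.sum_signSum h.increasing, Finset.sum_congr rfl fun i _ => h.influence_eq i k]
  simp

/-- Cauchy–Schwarz for `signSum` on `A`, with the second moment of `signSum` over the whole cube. -/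
lemma IsHammingBall.mul_influence_sq_le {n : ℕ} {A : Finset (Cube n)} (h : IsHammingBall A)
    (k : Fin n) : n * influence A k ^ 2 ≤ 4 := by
  have hn : (0 : ℝ) < n := by exact_mod_cast k.pos
  have h1 := Finset.sum_mul_sq_le_sq_mul_sq A (fun _ => (1 : ℝ)) signSum
  simp only [one_mul, one_pow, Finset.sum_const, nsmul_eq_mul, mul_one, h.sum_signSum k] at h1
  have h2 : ∑ x ∈ A, signSum x ^ 2 ≤ n * 2 ^ n := by
    rw [← sum_signSum_sq]
    exact Finset.sum_le_univ_sum_of_nonneg fun x => sq_nonneg _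
  have h3 : (A.card : ℝ) ≤ 2 ^ n := by
    rw [card_eq_mu]
    exact mul_le_of_le_one_right (by positivity) (mu_le_one A)
  have h4 : (2 ^ n * (n * influence A k / 2)) ^ 2 ≤ 2 ^ n * (n * (2 : ℝ) ^ n) :=
    h1.trans (mul_le_mul h3 h2 (Finset.sum_nonneg fun x _ => sq_nonneg _) (by positivity))
  have h5 : (0 : ℝ) < n * (2 ^ n) ^ 2 / 4 := by positivity
  refine le_of_mul_le_mul_left ?_ h5
  nlinarith

/-- The level-one inequality for Hamming balls. -/
lemma IsHammingBall.mul_influence_sq_le_log {n : ℕ} {A : Finset (Cube n)} (h : IsHammingBall A)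
    (k : Fin n) (hA : 0 < mu A) :
    n * influence A k ^ 2 ≤ 8 * mu A ^ 2 * Real.log (1 / mu A) := by
  have hn : (0 : ℝ) < n := by exact_mod_cast k.pos
  -- `v` is the mean of `signSum` over `A`, and `s = v / n` optimises the exponent below.
  set v : ℝ := n * influence A k / (2 * mu A) with hv
  set s : ℝ := v / n with hs
  have hS : ∑ x ∈ A, signSum x = 2 ^ n * (mu A * v) := by
    rw [h.sum_signSum k, hv]; field_simp
  -- Jensen's inequality in tangent-line form: the linear terms cancel because `v` is the mean.
  have h1 : ∑ x ∈ A, Real.exp (s * v) * (1 + (s * signSum x - s * v))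
      ≤ 2 ^ n * Real.cosh s ^ n := by
    rw [← sum_exp_signSum]
    refine (Finset.sum_le_sum fun x _ => ?_).trans
      (Finset.sum_le_univ_sum_of_nonneg fun x => (Real.exp_pos _).le)
    have h2 := Real.add_one_le_exp (s * signSum x - s * v)
    calc _ ≤ Real.exp (s * v) * Real.exp (s * signSum x - s * v) := by
          gcongr; linarith
      _ = _ := by rw [← Real.exp_add]; ring_nf
  have h3 : ∑ x ∈ A, Real.exp (s * v) * (1 + (s * signSum x - s * v))
      = 2 ^ n * (mu A * Real.exp (s * v)) := by
    rw [← Finset.mul_sum, Finset.sum_add_distrib, Finset.sum_sub_distrib, ← Finset.mul_sum, hS]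
    simp only [Finset.sum_const, nsmul_eq_mul, card_eq_mu]
    ring
  have h4 : Real.cosh s ^ n ≤ Real.exp (n * (s ^ 2 / 2)) := by
    rw [Real.exp_nat_mul]
    exact pow_le_pow_left₀ (Real.cosh_pos s).le (Real.cosh_le_exp_half_sq s) n
  rw [h3] at h1
  have h5 := (le_of_mul_le_mul_left h1 (by positivity)).trans h4
  have h6 := Real.log_le_log (by positivity) h5
  rw [Real.log_mul hA.ne' (Real.exp_pos _).ne', Real.log_exp, Real.log_exp] at h6
  rw [one_div, Real.log_inv]
  have h7 : n * influence A k ^ 2 = 4 * mu A ^ 2 * (v ^ 2 / n) := by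
    rw [hv]; field_simp; ring
  have h8 : s * v = v ^ 2 / n := by rw [hs]; field_simp
  have h9 : n * (s ^ 2 / 2) = v ^ 2 / n / 2 := by rw [hs]; field_simp
  rw [h8, h9] at h6
  rw [h7]
  have : 0 ≤ mu A ^ 2 := sq_nonneg _
  nlinarith

/-! ### Lower bounds for the tails of the sum -/

/-- The points whose sign sum is at least `r`. -/
noncomputable def tail (n : ℕ) (r : ℝ) : Finset (Cube n) :=
  Finset.univ.filter fun x => r ≤ signSum x

lemma mu_tail_neg (n : ℕ) (r : ℝ) :
    mu (Finset.univ.filter fun x : Cube n => signSum x ≤ -r) = mu (tail n r) := by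
  refine mu_congr (fun x i => !(x i)) ?_ ?_ (fun x => by simp) <;> intro x hx <;>
    simp [tail, signSum_not] at hx ⊢ <;> linarith

lemma mu_tail_add (n l : ℕ) (r s : ℝ) :
    mu (tail n r) * mu (tail l s) ≤ mu (tail (n + l) (r + s)) := by
  rw [← mu_andFamily]
  refine mu_mono fun z hz => ?_
  obtain ⟨x, y, rfl⟩ := append_surjective z
  rw [mem_andFamily_append] at hz
  simp only [tail, Finset.mem_filter, Finset.mem_univ, true_and, signSum_append] at hz ⊢
  linarith

lemma half_le_mu_tail_zero (n : ℕ) : 1 / 2 ≤ mu (tail n 0) := by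
  have h1 := mu_tail_neg n 0
  have h2 := mu_filter_add Finset.univ (fun x : Cube n => 0 ≤ signSum x)
  rw [mu_univ] at h2
  have h3 : mu (Finset.univ.filter fun x : Cube n => ¬ 0 ≤ signSum x)
      ≤ mu (Finset.univ.filter fun x : Cube n => signSum x ≤ -0) :=
    mu_mono fun x hx => by simp at hx ⊢; exact hx.le
  unfold tail at *
  linarith

/-- A Paley-Zygmund bound. -/
lemma tenth_le_mu_tail (n : ℕ) : 1 / 10 ≤ mu (tail n (Real.sqrt n / 2)) := by
  rcases Nat.eq_zero_or_pos n with rfl | hn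
  · have := half_le_mu_tail_zero 0
    simp at this ⊢
    linarith
  have hn' : (0 : ℝ) < n := by exact_mod_cast hn
  set r := Real.sqrt n / 2 with hr
  have hr2 : r ^ 2 = n / 4 := by rw [hr, div_pow, Real.sq_sqrt hn'.le]; norm_num
  have hr0 : 0 ≤ r := by positivity
  set D : Finset (Cube n) := Finset.univ.filter fun x => signSum x ≤ -r
  have hU : mu (tail n r ∪ D) ≤ 2 * mu (tail n r) := by
    have : mu (tail n r ∪ D) ≤ mu (tail n r) + mu D := by
      unfold mu
      rw [← add_div]
      gcongr
      exact_mod_cast Finset.card_union_le _ _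
    rw [mu_tail_neg] at this
    linarith
  -- With `w = u - 1/4`, the polynomial `w/2 - w²/16 = 1 - (w/4 - 1)²` is at most one, and
  -- nonpositive for `w ≤ 0`. The second and fourth moments make its mean at least `55/256 > 1/5`.
  have key : ∀ x : Cube n, (1 / 2 * (signSum x ^ 2 / n - 1 / 4)
      - 1 / 16 * (signSum x ^ 2 / n - 1 / 4) ^ 2) ≤ if x ∈ tail n r ∪ D then (1 : ℝ) else 0 := by
    intro x
    set u := signSum x ^ 2 / n with hu
    split_ifs with hx
    · nlinarith [sq_nonneg (1 / 4 * (u - 1 / 4) - 1)]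
    · simp only [tail, D, Finset.mem_union, Finset.mem_filter, Finset.mem_univ, true_and, not_or,
        not_le] at hx
      have h1 : signSum x ^ 2 ≤ n / 4 := by rw [← hr2]; nlinarith
      have h2 : u ≤ 1 / 4 := by rw [hu, div_le_iff₀ hn']; linarith
      nlinarith [sq_nonneg (u - 1 / 4)]
  have hsum := Finset.sum_le_sum fun x (_ : x ∈ Finset.univ) => key x
  have h2 := sum_signSum_sq n
  have h4 := sum_signSum_pow_four_le n
  have hP : (0 : ℝ) < 2 ^ n := by positivity
  have hexp : ∀ x : Cube n, (1 / 2 * (signSum x ^ 2 / n - 1 / 4)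
      - 1 / 16 * (signSum x ^ 2 / n - 1 / 4) ^ 2)
      = (17 / 32 / n) * signSum x ^ 2 - (1 / 16 / n ^ 2) * signSum x ^ 4 - 33 / 256 := by
    intro x; field_simp; ring
  simp only [hexp, Finset.sum_sub_distrib, ← Finset.mul_sum, h2] at hsum
  have h5 : (1 / 16 / (n : ℝ) ^ 2) * ∑ x : Cube n, signSum x ^ 4 ≤ 3 / 16 * 2 ^ n := by
    calc _ ≤ (1 / 16 / (n : ℝ) ^ 2) * (3 * n ^ 2 * 2 ^ n) := by gcongr
      _ = _ := by field_simp
  have h6 : (17 / 32 / (n : ℝ)) * (n * 2 ^ n) = 17 / 32 * 2 ^ n := by field_simp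
  have h7 : ∑ _x : Cube n, (33 / 256 : ℝ) = 33 / 256 * 2 ^ n := by simp; ring
  have h8 : (1 / 5 : ℝ) ≤ mu (tail n r ∪ D) := by
    rw [mu_eq_sum, le_div_iff₀ hP]
    linarith
  linarith

/-- Each of `k` independent blocks of length `N` has sum at least `√N / 2` with probability at least
`1/10`. -/
lemma mu_tail_mul (N k : ℕ) :
    (1 / 10 : ℝ) ^ k ≤ mu (tail (N * k) (k * (Real.sqrt N / 2))) := by
  induction k with
  | zero => simp [tail, signSum, mu]
  | succ k ih =>
    rw [pow_succ]
    refine (mul_le_mul ih (tenth_le_mu_tail N) (by norm_num) (mu_nonneg _)).trans ?_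
    refine (mu_tail_add _ _ _ _).trans (le_of_eq ?_)
    push_cast
    congr 2
    ring

/-- The `n % k` leftover coordinates have nonnegative sum with probability at least `1/2`. -/
lemma mu_tail_ge (n k : ℕ) :
    (1 / 10 : ℝ) ^ k / 2 ≤ mu (tail n (k * (Real.sqrt (n / k : ℕ) / 2))) := by
  have h := mul_le_mul (mu_tail_mul (n / k) k) (half_le_mu_tail_zero (n % k)) (by norm_num)
    (mu_nonneg _)
  rw [mul_one_div] at h
  refine h.trans ((mu_tail_add _ _ _ _).trans (le_of_eq ?_))
  rw [Nat.div_add_mod' n k, add_zero]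

lemma exp_neg_three_le : Real.exp (-3) ≤ 1 / 10 := by
  rw [Real.exp_neg, one_div]
  apply inv_anti₀ (by norm_num)
  have h := Real.exp_one_gt_d9
  have h3 : Real.exp 3 = Real.exp 1 ^ 3 := by rw [← Real.exp_nat_mul]; norm_num
  rw [h3]
  calc (10 : ℝ) ≤ 2.7 ^ 3 := by norm_num
    _ ≤ _ := by gcongr; linarith

/-! ### Influences of small Hamming balls -/

/-- The constants come from `log 10 < 3` and `log 4 < 2`. -/
lemma two_mul_lt_tenth_pow {a : ℝ} (ha : 0 < a) {k : ℕ} (hk : 3 * k + 2 ≤ Real.log (1 / a)) :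
    2 * a < (1 / 10 : ℝ) ^ k / 2 := by
  have h1 : Real.exp (-(3 * k)) ≤ (1 / 10 : ℝ) ^ k := by
    rw [show (-(3 * (k : ℝ))) = k * (-3) by ring, Real.exp_nat_mul]
    exact pow_le_pow_left₀ (Real.exp_pos _).le exp_neg_three_le k
  have h2 : a ≤ Real.exp (-(3 * k)) * Real.exp (-2) := by
    rw [← Real.exp_add, ← Real.log_le_iff_le_exp ha]
    rw [one_div, Real.log_inv] at hk
    linarith
  have h3 : Real.exp (-2) < 1 / 4 := by
    rw [Real.exp_neg, one_div]
    apply inv_strictAnti₀ (by norm_num)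
    have h := Real.exp_one_gt_d9
    rw [show (2 : ℝ) = (2 : ℕ) * 1 by norm_num, Real.exp_nat_mul]
    calc (4 : ℝ) < 2.7 ^ 2 := by norm_num
      _ ≤ _ := by gcongr; linarith
  have h4 := mul_lt_mul_of_pos_left h3 (Real.exp_pos (-(3 * (k : ℝ))))
  linarith

/-- The threshold of a small ball is large, so its influences are bounded below. -/
lemma IsHammingBall.le_mul_influence_sq {n : ℕ} {A : Finset (Cube n)} (h : IsHammingBall A)
    (i : Fin n) {a : ℝ} (ha : 0 < a) (hL : 8 ≤ Real.log (1 / a)) (hn : Real.log (1 / a) ≤ n)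
    (hA : mu A ≤ 2 * a) :
    mu A ^ 2 * Real.log (1 / a) / 16 ≤ n * influence A i ^ 2 := by
  set L := Real.log (1 / a) with hLdef
  have hn0 : (0 : ℝ) < n := by linarith
  -- The largest number of blocks for which the tail still has measure above `2a`; `L ≥ 8` is what
  -- gives `k ≥ L / 8`.
  set k : ℕ := ⌊(L - 2) / 3⌋₊ with hk
  have hk1 : (k : ℝ) ≤ (L - 2) / 3 := Nat.floor_le (by linarith)
  have hk2 : (L - 2) / 3 < k + 1 := Nat.lt_floor_add_one _
  have hk3 : L / 8 ≤ k := by linarith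
  have hk0 : (0 : ℝ) < k := by linarith
  have hk0' : 0 < k := by exact_mod_cast hk0
  set r : ℝ := k * (Real.sqrt (n / k : ℕ) / 2) with hr
  have hr0 : 0 ≤ r := by positivity
  have hdiv : (n : ℝ) ≤ 2 * k * (n / k : ℕ) := by
    have h1 : k ≤ n := by
      have : (k : ℝ) ≤ n := by linarith
      exact_mod_cast this
    have h2 : n < k * (n / k + 1) := Nat.lt_mul_div_succ n hk0'
    have h3 : 1 ≤ n / k := (Nat.one_le_div_iff hk0').2 h1
    have h4 : n ≤ 2 * k * (n / k) := by nlinarith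
    exact_mod_cast h4
  have hr2 : n * L / 64 ≤ r ^ 2 := by
    rw [hr, mul_pow, div_pow, Real.sq_sqrt (Nat.cast_nonneg _)]
    nlinarith
  obtain ⟨t, ht⟩ := h.exists_weight
  -- With a lower threshold, `A` would contain a tail of measure above `2a`.
  have hthr : r ≤ 2 * t - n := by
    by_contra! hlt
    have hsub : tail n r ⊆ A := by
      intro x hx
      simp only [tail, Finset.mem_filter, Finset.mem_univ, true_and, signSum_eq] at hx
      rw [ht]
      linarith
    have h1 := two_mul_lt_tenth_pow ha (k := k) (by linarith)
    have h2 := (mu_tail_ge n k).trans (mu_mono hsub)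
    linarith
  have hsum : 2 ^ n * (mu A * r) ≤ ∑ x ∈ A, signSum x := by
    rw [← mul_assoc, ← card_eq_mu, ← nsmul_eq_mul]
    refine Finset.card_nsmul_le_sum _ _ _ fun x hx => ?_
    rw [ht] at hx
    rw [signSum_eq]
    linarith
  rw [h.sum_signSum i] at hsum
  have h1 : mu A * r ≤ n * influence A i / 2 := le_of_mul_le_mul_left hsum (by positivity)
  have h2 : mu A ^ 2 * r ^ 2 ≤ (n * influence A i / 2) ^ 2 := by
    rw [← mul_pow]
    exact pow_le_pow_left₀ (mul_nonneg (mu_nonneg A) hr0) h1 2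
  have h3 := (mul_le_mul_of_nonneg_left hr2 (sq_nonneg (mu A))).trans h2
  refine le_of_mul_le_mul_left ?_ hn0
  nlinarith

lemma IsHammingBall.influence_bounds {n : ℕ} {A : Finset (Cube n)} (h : IsHammingBall A)
    (i : Fin n) {a : ℝ} (ha : 0 < a) (hL : 8 ≤ Real.log (1 / a)) (hn : Real.log (1 / a) ≤ n)
    (hA : a / 2 ≤ mu A) (hA' : mu A ≤ 2 * a) :
    a ^ 2 * Real.log (1 / a) / 64 ≤ n * influence A i ^ 2 ∧
      n * influence A i ^ 2 ≤ 64 * (a ^ 2 * Real.log (1 / a)) := by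
  have hmu : 0 < mu A := by linarith
  constructor
  · refine le_trans ?_ (h.le_mul_influence_sq i ha hL hn hA')
    have : (a / 2) ^ 2 ≤ mu A ^ 2 := by gcongr
    nlinarith
  · refine (h.mul_influence_sq_le_log i hmu).trans ?_
    have h1 : Real.log (1 / mu A) ≤ 2 * Real.log (1 / a) := by
      have : Real.log (1 / mu A) ≤ Real.log (2 * (1 / a)) := by
        apply Real.log_le_log (by positivity)
        rw [mul_one_div, div_le_div_iff₀ hmu ha]
        linarith
      rw [Real.log_mul two_ne_zero (by positivity)] at this
      have := Real.log_two_lt_d9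
      linarith
    have h2 : mu A ^ 2 ≤ (2 * a) ^ 2 := by gcongr
    calc _ ≤ 8 * (2 * a) ^ 2 * (2 * Real.log (1 / a)) := by
          gcongr
          exact Real.log_nonneg ((le_div_iff₀ hmu).2 (by linarith [mu_le_one A]))
      _ = _ := by ring

/-! ### The function `φ` -/

lemma phi_bounds {a W : ℝ} (ha : 0 < a) (hL : 8 ≤ Real.log (1 / a))
    (h1 : a ^ 2 * Real.log (1 / a) / 256 ≤ W) (h2 : W ≤ 100 * (a ^ 2 * Real.log (1 / a))) :
    a ^ 2 / 768 ≤ phi W ∧ phi W ≤ 200 * a ^ 2 := by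
  set L := Real.log (1 / a) with hLdef
  have hla : Real.log a = -L := by rw [hLdef, one_div, Real.log_inv, neg_neg]
  have hL0 : 0 < L := by linarith
  have hW : 0 < W := lt_of_lt_of_le (by positivity) h1
  have he := Real.exp_one_gt_d9
  have hden : Real.log (Real.exp 1 / W) = 1 - Real.log W := by
    rw [Real.log_div (Real.exp_pos 1).ne' hW.ne', Real.log_exp]
  have hup : Real.log W ≤ 6 - 15 / 8 * L := by
    have h3 := Real.log_le_log hW h2
    -- Splitting off `L / 8` lets `log (L / 8) ≤ L / 8 - 1` be absorbed by the main term `-2 * L`.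
    rw [show 100 * (a ^ 2 * L) = 800 * (a ^ 2 * (L / 8)) by ring,
      Real.log_mul (by norm_num) (by positivity), Real.log_mul (by positivity) (by positivity),
      Real.log_pow, hla] at h3
    have h4 := Real.log_le_sub_one_of_pos (show 0 < L / 8 by positivity)
    have h5 : Real.log 800 ≤ 7 := by
      rw [Real.log_le_iff_le_exp (by norm_num), show (7 : ℝ) = (7 : ℕ) * 1 by norm_num,
        Real.exp_nat_mul]
      calc (800 : ℝ) ≤ 2.7 ^ 7 := by norm_num
        _ ≤ _ := by gcongr; linarith
    push_cast at h3
    linarith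
  have hlo : -(4 + 2 * L) ≤ Real.log W := by
    have h3 : a ^ 2 * (1 / 32) ≤ W := by nlinarith [sq_nonneg a]
    have h4 := Real.log_le_log (by positivity) h3
    rw [Real.log_mul (by positivity) (by norm_num), Real.log_pow, hla, one_div, Real.log_inv] at h4
    have h5 : Real.log 32 ≤ 4 := by
      rw [Real.log_le_iff_le_exp (by norm_num), show (4 : ℝ) = (4 : ℕ) * 1 by norm_num,
        Real.exp_nat_mul]
      calc (32 : ℝ) ≤ 2.7 ^ 4 := by norm_num
        _ ≤ _ := by gcongr; linarith
    push_cast at h4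
    linarith
  unfold phi
  rw [hden]
  have hpos : 0 < 1 - Real.log W := by linarith
  constructor
  · rw [le_div_iff₀ hpos]
    calc a ^ 2 / 768 * (1 - Real.log W) ≤ a ^ 2 / 768 * (3 * L) := by gcongr; linarith
      _ ≤ W := by linarith
  · rw [div_le_iff₀ hpos]
    calc W ≤ 200 * a ^ 2 * (L / 2) := by linarith
      _ ≤ _ := by gcongr; linarith

/-- The constant is `1600 = 8 * 200`, from the lower bound on `cov` and the upper bound on `phi`. -/
lemma tightWith_of_bounds {n : ℕ} {A B : Finset (Cube n)} {a : ℝ} (ha : 0 < a)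
    (hL : 8 ≤ Real.log (1 / a)) (hA : Increasing A) (hB : Increasing B)
    (hc1 : a ^ 2 / 8 ≤ cov A B) (hc2 : cov A B ≤ a ^ 2)
    (hW1 : a ^ 2 * Real.log (1 / a) / 256 ≤ W1 A B)
    (hW2 : W1 A B ≤ 100 * (a ^ 2 * Real.log (1 / a))) : TightWith 1600 A B := by
  obtain ⟨h1, h2⟩ := phi_bounds ha hL hW1 hW2
  have := sq_nonneg a
  exact ⟨hA, hB, by linarith, by linarith⟩

/-! ### The two constructions -/

lemma mem_orFirst_append {n l : ℕ} {A : Finset (Cube n)} (x : Cube n) (y : Cube (l + 1)) :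
    Fin.append x y ∈ orFirst A (l + 1) ↔ x ∈ A ∨ y 0 = true := by
  simp only [orFirst, Finset.mem_filter, Finset.mem_univ, true_and, Fin.append_left,
    Fin.append_right]
  refine or_congr Iff.rfl ⟨?_, fun h => ⟨0, rfl, h⟩⟩
  rintro ⟨j, hj, h⟩
  rwa [show j = 0 from Fin.ext hj] at h

lemma append_le_append_iff {n l : ℕ} {x x' : Cube n} {y y' : Cube l} :
    Fin.append x y ≤ Fin.append x' y' ↔ x ≤ x' ∧ y ≤ y' := by
  refine ⟨fun h => ⟨fun i => ?_, fun i => ?_⟩, fun h i => ?_⟩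
  · simpa using h (Fin.castAdd l i)
  · simpa using h (Fin.natAdd n i)
  · refine Fin.addCases (fun j => ?_) (fun j => ?_) i
    · simpa using h.1 j
    · simpa using h.2 j

lemma increasing_orFirst {n l : ℕ} {A : Finset (Cube n)} (hA : Increasing A) :
    Increasing (orFirst A (l + 1)) := by
  intro z w hzw hz
  obtain ⟨x, y, rfl⟩ := append_surjective z
  obtain ⟨x', y', rfl⟩ := append_surjective w
  rw [append_le_append_iff] at hzw
  rw [Finset.mem_coe, mem_orFirst_append] at *
  exact hz.imp (fun h => hA hzw.1 h) (fun h => hzw.2 0 h)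

lemma increasing_andFamily {n l : ℕ} {B : Finset (Cube n)} {C : Finset (Cube l)}
    (hB : Increasing B) (hC : Increasing C) : Increasing (andFamily B C) := by
  intro z w hzw hz
  obtain ⟨x, y, rfl⟩ := append_surjective z
  obtain ⟨x', y', rfl⟩ := append_surjective w
  rw [append_le_append_iff] at hzw
  rw [Finset.mem_coe, mem_andFamily_append] at *
  exact ⟨hB hzw.1 hz.1, hC hzw.2 hz.2⟩

lemma mu_orFirst {n l : ℕ} (A : Finset (Cube n)) :
    mu (orFirst A (l + 1)) = (1 + mu A) / 2 := by
  have h : (orFirst A (l + 1))ᶜ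
      = andFamily Aᶜ (Finset.univ.filter fun y : Cube (l + 1) => ¬ y 0 = true) :=
    ext_append fun x y => by
      simp only [Finset.mem_compl, mem_orFirst_append, mem_andFamily_append, Finset.mem_filter,
        Finset.mem_univ, true_and, not_or]
  have h2 := mu_compl (orFirst A (l + 1))
  rw [h, mu_andFamily, mu_compl, mu_not_coord] at h2
  linarith

lemma influence_orFirst_castAdd {n l : ℕ} (A : Finset (Cube n)) (i : Fin n) :
    influence (orFirst A (l + 1)) (Fin.castAdd (l + 1) i) = influence A i / 2 := by
  have h : ((orFirst A (l + 1)).filter fun z => flip z (Fin.castAdd (l + 1) i) ∉ orFirst A (l + 1))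
      = andFamily (A.filter fun x => flip x i ∉ A)
        (Finset.univ.filter fun y : Cube (l + 1) => ¬ y 0 = true) :=
    ext_append fun x y => by
      simp only [Finset.mem_filter, flip_append_castAdd, mem_orFirst_append, mem_andFamily_append,
        Finset.mem_univ, true_and]
      tauto
  unfold influence
  rw [h, mu_andFamily, mu_not_coord]
  ring

lemma influence_orFirst_natAdd_zero {n l : ℕ} (A : Finset (Cube n)) :
    influence (orFirst A (l + 1)) (Fin.natAdd n 0) = 1 - mu A := by
  have h : ((orFirst A (l + 1)).filter fun z => flip z (Fin.natAdd n 0) ∉ orFirst A (l + 1))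
      = andFamily Aᶜ (Finset.univ.filter fun y : Cube (l + 1) => y 0 = true) :=
    ext_append fun x y => by
      simp only [Finset.mem_filter, flip_append_natAdd, mem_orFirst_append, mem_andFamily_append,
        Finset.mem_univ, true_and, Finset.mem_compl, flip_same]
      cases y 0 <;> simp
  unfold influence
  rw [h, mu_andFamily, mu_coord, mu_compl]
  ring

lemma influence_orFirst_natAdd_succ {n l : ℕ} (A : Finset (Cube n)) (j : Fin l) :
    influence (orFirst A (l + 1)) (Fin.natAdd n j.succ) = 0 := by
  have h : ((orFirst A (l + 1)).filter fun z => flip z (Fin.natAdd n j.succ) ∉ orFirst A (l + 1))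
      = ∅ :=
    ext_append fun x y => by
      have h0 : flip y j.succ 0 = y 0 := by simp [flip, (Fin.succ_ne_zero j).symm]
      simp only [Finset.mem_filter, flip_append_natAdd, mem_orFirst_append, h0]
      simp only [Finset.notMem_empty, iff_false]
      tauto
  unfold influence
  rw [h, mu_empty, mul_zero]

lemma influence_andFamily_castAdd {n l : ℕ} (B : Finset (Cube n)) (C : Finset (Cube l))
    (i : Fin n) : influence (andFamily B C) (Fin.castAdd l i) = influence B i * mu C := by
  have h : ((andFamily B C).filter fun z => flip z (Fin.castAdd l i) ∉ andFamily B C)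
      = andFamily (B.filter fun x => flip x i ∉ B) C :=
    ext_append fun x y => by
      simp only [Finset.mem_filter, flip_append_castAdd, mem_andFamily_append]
      tauto
  unfold influence
  rw [h, mu_andFamily]
  ring

lemma influence_andFamily_natAdd {n l : ℕ} (B : Finset (Cube n)) (C : Finset (Cube l))
    (j : Fin l) : influence (andFamily B C) (Fin.natAdd n j) = mu B * influence C j := by
  have h : ((andFamily B C).filter fun z => flip z (Fin.natAdd n j) ∉ andFamily B C)
      = andFamily B (C.filter fun x => flip x j ∉ C) :=
    ext_append fun x y => by
      simp only [Finset.mem_filter, flip_append_natAdd, mem_andFamily_append]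
      tauto
  unfold influence
  rw [h, mu_andFamily]
  ring

lemma W1_orFirst {n l : ℕ} (A : Finset (Cube n)) (F : Finset (Cube (n + (l + 1)))) :
    W1 (orFirst A (l + 1)) F
      = ∑ i, influence A i / 2 * influence F (Fin.castAdd (l + 1) i)
        + (1 - mu A) * influence F (Fin.natAdd n 0) := by
  unfold W1
  rw [Fin.sum_univ_add, Fin.sum_univ_succ]
  simp [influence_orFirst_castAdd, influence_orFirst_natAdd_zero, influence_orFirst_natAdd_succ]

/-- Split the intersection by `y 0`: if it is true, the disjunction is automatic; if it is false, `x
∈ A` already forces `x ∈ B`. -/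
lemma cov_orFirst_andFamily {n l : ℕ} {A B : Finset (Cube n)} {C : Finset (Cube (l + 1))}
    (hAB : A ⊆ B) (hC : Increasing C) (hC2 : mu C = 1 / 2) (hB : mu B = 1 - mu A) :
    cov (orFirst A (l + 1)) (andFamily B C)
      = mu A ^ 2 / 4 + (1 - 2 * mu A) * influence C 0 / 4 := by
  have h : orFirst A (l + 1) ∩ andFamily B C
      = andFamily B (C.filter fun y => y 0 = true) ∪ andFamily A (C.filter fun y => ¬ y 0 = true) :=
    ext_append fun x y => by
      have := @hAB x
      simp only [Finset.mem_inter, Finset.mem_union, mem_orFirst_append, mem_andFamily_append,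
        Finset.mem_filter]
      tauto
  have hd : Disjoint (andFamily B (C.filter fun y => y 0 = true))
      (andFamily A (C.filter fun y => ¬ y 0 = true)) := by
    rw [Finset.disjoint_left]
    intro z h1 h2
    obtain ⟨x, y, rfl⟩ := append_surjective z
    simp only [mem_andFamily_append, Finset.mem_filter] at h1 h2
    exact h2.2.2 h1.2.2
  unfold cov
  rw [h, mu_union hd]
  simp only [mu_andFamily, mu_orFirst, mu_filter_true hC, mu_filter_not_true hC, hC2, hB]
  ring

lemma cov_orFirst_one {n : ℕ} {A : Finset (Cube n)} {F : Finset (Cube (n + 1))}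
    (hF : Increasing F) (h0 : ∀ x ∈ A, ∀ y : Cube 1, Fin.append x y ∈ F) :
    cov (orFirst A 1) F
      = mu A * (1 - mu F) / 2 + influence F (Fin.natAdd n 0) / 4 := by
  have h : orFirst A 1 ∩ F = (F.filter fun z => z (Fin.natAdd n 0) = true)
      ∪ andFamily A (Finset.univ.filter fun y : Cube 1 => ¬ y 0 = true) :=
    ext_append fun x y => by
      have := h0 x
      simp only [Finset.mem_inter, Finset.mem_union, mem_orFirst_append (l := 0),
        mem_andFamily_append, Finset.mem_filter, Fin.append_right, Finset.mem_univ, true_and]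
      by_cases hx : x ∈ A <;> by_cases hy : y 0 = true <;> simp_all
  have hd : Disjoint (F.filter fun z => z (Fin.natAdd n 0) = true)
      (andFamily A (Finset.univ.filter fun y : Cube 1 => ¬ y 0 = true)) := by
    rw [Finset.disjoint_left]
    intro z h1 h2
    obtain ⟨x, y, rfl⟩ := append_surjective z
    simp only [mem_andFamily_append, Finset.mem_filter, Fin.append_right] at h1 h2
    exact h2.2.2 h1.2
  unfold cov
  rw [h, mu_union hd]
  simp only [mu_andFamily, mu_orFirst (l := 0), mu_filter_true hF, mu_not_coord]
  ring

/-! ### Tightness -/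

lemma IsHammingBall.influence_le {n : ℕ} {A : Finset (Cube n)} (h : IsHammingBall A)
    (i : Fin n) {d : ℝ} (hd : 0 < d) (hn : 4 / d ^ 2 < n) : influence A i ≤ d := by
  by_contra! hlt
  have h1 := h.mul_influence_sq_le i
  rw [div_lt_iff₀ (by positivity)] at hn
  have h2 : d ^ 2 < influence A i ^ 2 := by gcongr
  have h3 : (0 : ℝ) < n := by exact_mod_cast i.pos
  nlinarith

lemma IsHammingBall.subset_or_subset {n : ℕ} {A B : Finset (Cube n)} (hA : IsHammingBall A)
    (hB : IsHammingBall B) : A ⊆ B ∨ B ⊆ A := by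
  obtain ⟨t, ht⟩ := hA.exists_weight
  obtain ⟨s, hs⟩ := hB.exists_weight
  rcases le_total s t with h | h
  · exact Or.inl fun x hx => (hs x).2 (h.trans_lt ((ht x).1 hx))
  · exact Or.inr fun x hx => (ht x).2 (h.trans_lt ((hs x).1 hx))

lemma le_eighth_of_log {a : ℝ} (ha : 0 < a) (hL : 8 ≤ Real.log (1 / a)) : a ≤ 1 / 9 := by
  have h := Real.log_le_sub_one_of_pos (show 0 < 1 / a by positivity)
  have h2 : 9 ≤ 1 / a := by linarith
  rw [le_div_iff₀ ha] at h2
  linarith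

/-- The hypothesis compares the slices `y = 0` of the cylinder over `A` and of `F`. Were the
threshold of `F` the larger one, its slice would lie inside that of `A`. -/
lemma append_mem_of_ball {n : ℕ} {A : Finset (Cube n)} {F : Finset (Cube (n + 1))}
    (hA : IsHammingBall A) (hF : IsHammingBall F)
    (h : mu A / 2 < mu F / 2 - influence F (Fin.natAdd n 0) / 4) :
    ∀ x ∈ A, ∀ y : Cube 1, Fin.append x y ∈ F := by
  obtain ⟨t, ht⟩ := hA.exists_weight
  obtain ⟨s, hs⟩ := hF.exists_weight
  rcases le_total s t with hst | hst
  · intro x hx y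
    have hy : 0 ≤ weight y := Finset.sum_nonneg fun i _ => by positivity
    rw [ht] at hx
    rw [hs, weight_append]
    linarith
  · exfalso
    rw [← mu_filter_not_true hF.increasing] at h
    have hsub : F.filter (fun z => ¬ z (Fin.natAdd n 0) = true)
        ⊆ andFamily A (Finset.univ.filter fun y : Cube 1 => ¬ y 0 = true) := by
      intro z hz
      obtain ⟨x, y, rfl⟩ := append_surjective z
      simp only [Finset.mem_filter, Fin.append_right, hs, weight_append] at hz
      simp only [mem_andFamily_append, Finset.mem_filter, Finset.mem_univ, true_and]
      refine ⟨(ht x).2 ?_, hz.2⟩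
      have hy : weight y = 0 := by simp [weight, hz.2]
      linarith [hz.1]
    have h2 := mu_mono hsub
    rw [mu_andFamily, mu_not_coord] at h2
    linarith

lemma tightWith_orFirst_ball {n : ℕ} {A : Finset (Cube n)} {F : Finset (Cube (n + 1))} {a : ℝ}
    (ha : 0 < a) (hL : 8 ≤ Real.log (1 / a)) (hA : IsHammingBall A) (hF : IsHammingBall F)
    (hn : Real.log (1 / a) ≤ n) (hn' : 4 / (a ^ 2) ^ 2 < n)
    (hA1 : 9 / 10 * a ≤ mu A) (hA2 : mu A ≤ 11 / 10 * a)
    (hF1 : 9 / 10 * a ≤ 1 - mu F) (hF2 : 1 - mu F ≤ 11 / 10 * a) :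
    TightWith 1600 (orFirst A 1) F := by
  have ha9 := le_eighth_of_log ha hL
  have hn0 : (0 : ℝ) < n := by linarith
  have hn1 : 0 < n := by exact_mod_cast hn0
  have hcast : ((n + 1 : ℕ) : ℝ) = n + 1 := by push_cast; rfl
  set J := influence F (Fin.natAdd n 0) with hJ
  set I := influence A ⟨0, hn1⟩ with hI
  have hI0 : 0 ≤ I := influence_nonneg _ _
  have hJ0 : 0 ≤ J := influence_nonneg _ _
  have hJa : J ≤ a ^ 2 := hF.influence_le _ (by positivity) (by rw [hcast]; linarith)
  have hmem := append_mem_of_ball hA hF (by rw [← hJ]; nlinarith)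
  obtain ⟨hI1, hI2⟩ := hA.influence_bounds ⟨0, hn1⟩ ha hL hn (by linarith) (by linarith)
  -- `F` has measure near one; its dual is a small ball with the same influences.
  obtain ⟨hJ1, hJ2⟩ := hF.dual.influence_bounds (Fin.natAdd n 0) ha hL
    (by rw [hcast]; linarith) (by rw [mu_dual]; linarith) (by rw [mu_dual]; linarith)
  rw [influence_dual, hcast, ← hJ] at hJ1 hJ2
  rw [← hI] at hI1 hI2
  set M := a ^ 2 * Real.log (1 / a) with hM
  have hM0 : 0 < M := by positivity
  have hMa : a ^ 2 ≤ M := by nlinarith [sq_nonneg a]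
  have hn1' : (1 : ℝ) ≤ n := by exact_mod_cast hn1
  have hW : W1 (orFirst A 1) F = n * I * J / 2 + (1 - mu A) * J := by
    rw [W1_orFirst (l := 0), Finset.sum_congr rfl fun i _ => by
      rw [hA.influence_eq i ⟨0, hn1⟩, hF.influence_eq _ (Fin.natAdd n 0)]]
    simp only [Finset.sum_const, Finset.card_univ, Fintype.card_fin, nsmul_eq_mul]
    ring
  -- `n * I * J` is the geometric mean of `n * I ^ 2` and `n * J ^ 2`, both of order `M`.
  have hlow : M / 100 ≤ n * I * J := by
    have h1 : M / 128 ≤ n * J ^ 2 := by nlinarith [sq_nonneg J]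
    have h2 : (M / 100) ^ 2 ≤ (n * I * J) ^ 2 := by
      calc (M / 100) ^ 2 ≤ M / 64 * (M / 128) := by nlinarith
        _ ≤ (n * I ^ 2) * (n * J ^ 2) := by gcongr
        _ = _ := by ring
    exact le_of_sq_le_sq h2 (by positivity)
  have hupp : n * I * J ≤ 64 * M := by nlinarith [sq_nonneg (I - J), sq_nonneg J]
  have hJm : (1 - mu A) * J ≤ J := by nlinarith [mu_nonneg A]
  have hJm0 : 0 ≤ (1 - mu A) * J := mul_nonneg (by linarith) hJ0
  refine tightWith_of_bounds ha hL (increasing_orFirst (l := 0) hA.increasing) hF.increasing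
    ?_ ?_ ?_ ?_
  · rw [cov_orFirst_one hF.increasing hmem, ← hJ]
    have : (9 / 10 * a) * (9 / 10 * a) ≤ mu A * (1 - mu F) :=
      mul_le_mul hA1 hF1 (by positivity) (mu_nonneg A)
    nlinarith
  · rw [cov_orFirst_one hF.increasing hmem, ← hJ]
    have : mu A * (1 - mu F) ≤ (11 / 10 * a) * (11 / 10 * a) := by
      gcongr
      linarith
    nlinarith
  · rw [hW, ← hM]; linarith
  · rw [hW, ← hM]; linarith

lemma tightWith_orFirst_andFamily {n l : ℕ} {A : Finset (Cube n)} {C : Finset (Cube l)} {a : ℝ}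
    (ha : 0 < a) (hL : 8 ≤ Real.log (1 / a)) (hA : IsHammingBall A) (hC : IsHammingBall C)
    (hn : Real.log (1 / a) ≤ n) (hA1 : 9 / 10 * a ≤ mu A) (hA2 : mu A ≤ 11 / 10 * a)
    (hC2 : mu C = 1 / 2) (hCI : ∀ i, influence C i ≤ a ^ 2) :
    TightWith 1600 (orFirst A l) (andFamily (dual A) C) := by
  have ha9 := le_eighth_of_log ha hL
  obtain _ | l := l
  -- The one-point cube has no family of measure `1/2`.
  · exfalso
    have h1 : (2 * C.card : ℝ) = 1 := by
      rw [card_eq_mu, hC2]; norm_num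
    have h2 : 2 * C.card = 1 := by exact_mod_cast h1
    omega
  have hn0 : (0 : ℝ) < n := by linarith
  have hn1 : 0 < n := by exact_mod_cast hn0
  have hB := mu_dual A
  have hAB : A ⊆ dual A := by
    refine (hA.subset_or_subset hA.dual).resolve_right fun h => ?_
    have := mu_mono h
    linarith
  set I := influence A ⟨0, hn1⟩ with hI
  set J := influence C 0 with hJ
  have hJ0 : 0 ≤ J := influence_nonneg _ _
  have hJa : J ≤ a ^ 2 := hCI 0
  obtain ⟨hI1, hI2⟩ := hA.influence_bounds ⟨0, hn1⟩ ha hL hn (by linarith) (by linarith)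
  rw [← hI] at hI1 hI2
  set M := a ^ 2 * Real.log (1 / a) with hM
  have hM0 : 0 < M := by positivity
  have hMa : a ^ 2 ≤ M := by nlinarith [sq_nonneg a]
  have hW : W1 (orFirst A (l + 1)) (andFamily (dual A) C)
      = n * I ^ 2 / 4 + (1 - mu A) * ((1 - mu A) * J) := by
    rw [W1_orFirst, Finset.sum_congr rfl fun i _ => by
      rw [influence_andFamily_castAdd, influence_dual, hA.influence_eq i ⟨0, hn1⟩, hC2],
      influence_andFamily_natAdd, hB]
    simp only [Finset.sum_const, Finset.card_univ, Fintype.card_fin, nsmul_eq_mul]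
    ring
  have h1 : (1 - mu A) * J ≤ J := by nlinarith [mu_nonneg A]
  have h10 : 0 ≤ (1 - mu A) * J := mul_nonneg (by linarith) hJ0
  have h2 : (1 - mu A) * ((1 - mu A) * J) ≤ J := by nlinarith [mu_nonneg A]
  have h20 : 0 ≤ (1 - mu A) * ((1 - mu A) * J) := mul_nonneg (by linarith) h10
  have h3 : (1 - 2 * mu A) * J ≤ J := by nlinarith [mu_nonneg A]
  have h30 : 0 ≤ (1 - 2 * mu A) * J := mul_nonneg (by linarith) hJ0
  have h4 : (9 / 10 * a) ^ 2 ≤ mu A ^ 2 := by gcongr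
  have h5 : mu A ^ 2 ≤ (11 / 10 * a) ^ 2 := by gcongr; exact mu_nonneg A
  refine tightWith_of_bounds ha hL (increasing_orFirst hA.increasing)
    (increasing_andFamily hA.dual.increasing hC.increasing) ?_ ?_ ?_ ?_
  · rw [cov_orFirst_andFamily hAB hC.increasing hC2 hB, ← hJ]; nlinarith
  · rw [cov_orFirst_andFamily hAB hC.increasing hC2 hB, ← hJ]; nlinarith
  · rw [hW, ← hM]; linarith
  · rw [hW, ← hM]; linarith

/-! ### Existence of balls -/

/-- The points with at least `m` ones. -/
noncomputable def upperBall (n m : ℕ) : Finset (Cube n) :=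
  Finset.univ.filter fun x => (m : ℝ) - 1 / 2 < weight x

lemma mem_upperBall {n m : ℕ} {x : Cube n} : x ∈ upperBall n m ↔ (m : ℝ) - 1 / 2 < weight x := by
  simp [upperBall]

lemma isHammingBall_upperBall (n m : ℕ) : IsHammingBall (upperBall n m) :=
  ⟨m - 1 / 2, fun _ => mem_upperBall⟩

lemma mu_upperBall_zero (n : ℕ) : mu (upperBall n 0) = 1 := by
  rw [← mu_univ n]
  congr 1
  ext x
  have : 0 ≤ weight x := Finset.sum_nonneg fun i _ => by positivity
  simp only [mem_upperBall, Finset.mem_univ, iff_true]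
  push_cast
  linarith

lemma mu_upperBall_of_lt {n m : ℕ} (h : n < m) : mu (upperBall n m) = 0 := by
  rw [← mu_empty n]
  congr 1
  ext x
  have h1 : weight x ≤ n := by
    have : weight x ≤ ∑ _i : Fin n, (1 : ℝ) :=
      Finset.sum_le_sum fun i _ => by split_ifs <;> norm_num
    simpa using this
  have h2 : (n : ℝ) + 1 ≤ m := by exact_mod_cast h
  simp only [mem_upperBall, Finset.notMem_empty, iff_false, not_lt]
  linarith

lemma cons_true_mem_upperBall {n m : ℕ} {x : Cube n} :
    (Fin.cons true x : Cube (n + 1)) ∈ upperBall (n + 1) (m + 1) ↔ x ∈ upperBall n m := by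
  simp only [mem_upperBall, weight_cons, if_true]
  push_cast
  constructor <;> intro h <;> linarith

lemma cons_false_mem_upperBall {n m : ℕ} {x : Cube n} :
    (Fin.cons false x : Cube (n + 1)) ∈ upperBall (n + 1) m ↔ x ∈ upperBall n m := by
  simp [mem_upperBall, weight_cons]

lemma mu_upperBall_succ (n m : ℕ) :
    mu (upperBall (n + 1) (m + 1)) = (mu (upperBall n m) + mu (upperBall n (m + 1))) / 2 := by
  simp only [mu_eq_sum, sum_cube_succ, cons_true_mem_upperBall, cons_false_mem_upperBall,
    Finset.sum_add_distrib, pow_succ]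
  field_simp

/-- By symmetry take the first coordinate: it is pivotal exactly when the others have `m` ones. -/
lemma influence_upperBall (n m : ℕ) (i : Fin (n + 1)) :
    influence (upperBall (n + 1) (m + 1)) i = mu (upperBall n m) - mu (upperBall n (m + 1)) := by
  rw [(isHammingBall_upperBall _ _).influence_eq i 0]
  have h1 : mu ((upperBall (n + 1) (m + 1)).filter fun x => x 0 = true)
      = mu (upperBall n m) / 2 := by
    simp only [mu_eq_sum, sum_cube_succ, Finset.mem_filter, cons_true_mem_upperBall, Fin.cons_zero,
      pow_succ, and_true, Bool.false_eq_true, and_false, if_false, add_zero]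
    field_simp
  have h2 := mu_filter_true (isHammingBall_upperBall (n + 1) (m + 1)).increasing 0
  rw [h1, mu_upperBall_succ] at h2
  linarith

lemma mu_upperBall_sub (n m : ℕ) :
    mu (upperBall n m) - mu (upperBall n (m + 1)) = (n.choose m : ℝ) / 2 ^ n := by
  induction n generalizing m with
  | zero =>
    cases m with
    | zero => rw [mu_upperBall_zero, mu_upperBall_of_lt (Nat.succ_pos _)]; simp
    | succ m =>
      rw [mu_upperBall_of_lt (Nat.succ_pos _), mu_upperBall_of_lt (Nat.succ_pos _)]
      simp
  | succ n ih =>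
    cases m with
    | zero =>
      have := ih 0
      rw [mu_upperBall_zero] at this ⊢
      rw [mu_upperBall_succ, mu_upperBall_zero, pow_succ, ← div_div]
      simp at this ⊢
      linarith
    | succ m =>
      have h1 := ih m
      have h2 := ih (m + 1)
      rw [mu_upperBall_succ, mu_upperBall_succ, Nat.choose_succ_succ, pow_succ, ← div_div]
      push_cast
      rw [add_div _ _ ((2 : ℝ) ^ n), ← h1, ← h2]
      ring

/-- Take the last ball of measure above `b`. Its distance from `b` is at most the jump to the next
ball, an influence in dimension `n + 1`. -/
lemma exists_upperBall (n : ℕ) {b : ℝ} (hb0 : 0 < b) (hb1 : b < 1) :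
    ∃ m, (n + 1) * (mu (upperBall n m) - b) ^ 2 ≤ 4 := by
  classical
  have hex : ∃ m, mu (upperBall n m) ≤ b :=
    ⟨n + 1, by rw [mu_upperBall_of_lt n.lt_succ_self]; exact hb0.le⟩
  obtain ⟨m, hm⟩ : ∃ m, Nat.find hex = m + 1 := by
    refine Nat.exists_eq_succ_of_ne_zero fun h => ?_
    have := Nat.find_spec hex
    rw [h, mu_upperBall_zero] at this
    linarith
  have h1 : mu (upperBall n (m + 1)) ≤ b := hm ▸ Nat.find_spec hex
  have h2 : b < mu (upperBall n m) := not_le.1 (Nat.find_min hex (by omega))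
  refine ⟨m, ?_⟩
  have h3 := (isHammingBall_upperBall (n + 1) (m + 1)).mul_influence_sq_le 0
  rw [influence_upperBall] at h3
  push_cast at h3
  have h4 : (mu (upperBall n m) - b) ^ 2
      ≤ (mu (upperBall n m) - mu (upperBall n (m + 1))) ^ 2 :=
    pow_le_pow_left₀ (by linarith) (by linarith) 2
  exact (mul_le_mul_of_nonneg_left h4 (by positivity)).trans h3

lemma exists_isBallSeq {b : ℝ} (hb0 : 0 < b) (hb1 : b < 1) :
    ∃ A : ∀ n, Finset (Cube n), IsBallSeq (fun n => n) b A := by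
  choose m hm using fun n => exists_upperBall n hb0 hb1
  refine ⟨fun n => upperBall n (m n), fun n => isHammingBall_upperBall _ _, ?_⟩
  rw [Metric.tendsto_atTop]
  intro e he
  obtain ⟨N, hN⟩ := exists_nat_gt (4 / e ^ 2)
  refine ⟨N, fun n hn => ?_⟩
  rw [Real.dist_eq]
  by_contra! hlt
  have h1 := hm n
  rw [div_lt_iff₀ (by positivity)] at hN
  have h2 : e ^ 2 ≤ (mu (upperBall n (m n)) - b) ^ 2 := by
    rw [← sq_abs (mu (upperBall n (m n)) - b)]; gcongr
  have h3 : (N : ℝ) ≤ n := by exact_mod_cast hn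
  have : (N : ℝ) * e ^ 2 ≤ (n + 1) * (mu (upperBall n (m n)) - b) ^ 2 := by
    gcongr; linarith
  linarith

/-! ### Balanced balls -/

/-- Majority in odd dimension is self-dual, as ties cannot occur. -/
lemma mu_majority (k : ℕ) : mu (upperBall (2 * k + 1) (k + 1)) = 1 / 2 := by
  have h : dual (upperBall (2 * k + 1) (k + 1)) = upperBall (2 * k + 1) (k + 1) := by
    ext x
    have hw : weight x = ((Finset.univ.filter fun i => x i = true).card : ℝ) := by simp [weight]
    have hne : (k : ℝ) + 1 / 2 ≠ weight x := by
      rw [hw]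
      intro h
      have h1 : 2 * (k : ℝ) + 1 = 2 * ((Finset.univ.filter fun i => x i = true).card : ℝ) := by
        linarith
      have h2 : 2 * k + 1 = 2 * (Finset.univ.filter fun i => x i = true).card := by
        exact_mod_cast h1
      omega
    simp only [dual, Finset.mem_filter, Finset.mem_univ, true_and, mem_upperBall, weight_not]
    push_cast
    constructor
    · intro h
      have := lt_of_le_of_ne (by linarith) hne
      linarith
    · intro h
      linarith
  have h2 := mu_dual (upperBall (2 * k + 1) (k + 1))
  rw [h] at h2
  linarith

lemma influence_majority (k : ℕ) (i : Fin (2 * k + 1)) :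
    influence (upperBall (2 * k + 1) (k + 1)) i = (k.centralBinom : ℝ) / 4 ^ k := by
  rw [influence_upperBall, mu_upperBall_sub, Nat.centralBinom_eq_two_mul_choose, pow_mul]
  norm_num

/-- Consecutive majority influences have ratio `(2k+1)/(2k+2)`, so the first one not above `t`
misses it by at most `t/(2k+1)`; the lower bound `1/(2(k+1))` for that influence makes this `O(t²)`.
-/
lemma exists_influence_majority_near {t : ℝ} (ht0 : 0 < t) (ht1 : t < 1) :
    ∃ k : ℕ, ∀ i, |influence (upperBall (2 * k + 1) (k + 1)) i - t| ≤ 2 * t ^ 2 := by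
  classical
  set c : ℕ → ℝ := fun k => (k.centralBinom : ℝ) / 4 ^ k with hc
  have hex : ∃ k, c k ≤ t := by
    obtain ⟨k, hk⟩ := exists_nat_gt (4 / t ^ 2)
    refine ⟨k, ?_⟩
    have h := (isHammingBall_upperBall (2 * k + 1) (k + 1)).influence_le 0 ht0
      (hk.trans_le (by exact_mod_cast (by omega)))
    rwa [influence_majority] at h
  obtain ⟨k, hk⟩ : ∃ k, Nat.find hex = k + 1 := by
    refine Nat.exists_eq_succ_of_ne_zero fun h => ?_
    have := Nat.find_spec hex
    rw [h] at this
    simp [hc] at this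
    linarith
  have h1 : c (k + 1) ≤ t := hk ▸ Nat.find_spec hex
  have h2 : t < c k := not_le.1 (Nat.find_min hex (by omega))
  refine ⟨k + 1, fun i => ?_⟩
  rw [influence_majority]
  change |c (k + 1) - t| ≤ _
  have hrec : ((k : ℝ) + 1) * c (k + 1) = (2 * k + 1) / 2 * c k := by
    have h3 : ((k : ℝ) + 1) * (k + 1).centralBinom = 2 * (2 * k + 1) * k.centralBinom := by
      exact_mod_cast Nat.succ_mul_centralBinom_succ k
    simp only [hc]
    rw [← mul_div_assoc, h3, pow_succ]
    field_simp
    ring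
  have hlow : 1 ≤ 2 * ((k : ℝ) + 1) * c (k + 1) := by
    have h3 : (4 : ℝ) ^ (k + 1) ≤ 2 * (k + 1) * (k + 1).centralBinom := by
      exact_mod_cast Nat.four_pow_le_two_mul_self_mul_centralBinom (k + 1) k.succ_pos
    simp only [hc]
    rw [← mul_div_assoc, one_le_div (by positivity)]
    exact h3
  have hk0 : (0 : ℝ) ≤ k := Nat.cast_nonneg k
  have h4 : (2 * k + 1) * (t - c (k + 1)) ≤ t := by nlinarith
  have h5 : 1 ≤ 2 * (k + 1) * t := by nlinarith
  rw [abs_sub_comm, abs_of_nonneg (by linarith)]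
  have h6 : t ≤ (2 * k + 1) * (2 * t ^ 2) := by nlinarith
  exact le_of_mul_le_mul_left (h4.trans h6) (by positivity)

/-- If all balls `B n` have small positive influences, they are matched by balanced balls. -/
lemma exists_isMatchingBalanced {B : ∀ n, Finset (Cube n)} (hB : ∀ n, IsHammingBall (B n))
    (hpos : ∀ᶠ n in atTop, ∀ j, 0 < influence (B n) j) :
    ∃ (l : ℕ → ℕ) (C : ∀ n, Finset (Cube (l n))), IsMatchingBalanced B l C := by
  have hex : ∀ n, ∃ k : ℕ, (∀ j : Fin n, 0 < influence (B n) j ∧ influence (B n) j < 1) →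
      ∀ (j : Fin n) i, |influence (upperBall (2 * k + 1) (k + 1)) i - influence (B n) j|
        ≤ 2 * influence (B n) j ^ 2 := by
    intro n
    rcases Nat.eq_zero_or_pos n with rfl | hn
    · exact ⟨0, fun _ j => j.elim0⟩
    · by_cases h : ∀ j : Fin n, 0 < influence (B n) j ∧ influence (B n) j < 1
      · obtain ⟨k, hk⟩ := exists_influence_majority_near (h ⟨0, hn⟩).1 (h ⟨0, hn⟩).2
        refine ⟨k, fun _ j i => ?_⟩
        rw [(hB n).influence_eq j ⟨0, hn⟩]
        exact hk i
      · exact ⟨0, fun h' => absurd h' h⟩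
  choose k hk using hex
  refine ⟨fun n => 2 * k n + 1, fun n => upperBall (2 * k n + 1) (k n + 1),
    fun n => ⟨isHammingBall_upperBall _ _, mu_majority _⟩, fun e he => ?_⟩
  -- The relative error is at most twice the influence, hence at most `e`; the bound `1/2` keeps the
  -- influence below one.
  set d := min (1 / 2) (e / 2) with hd
  have hd0 : 0 < d := by positivity
  obtain ⟨N, hN⟩ := exists_nat_gt (4 / d ^ 2)
  filter_upwards [hpos, eventually_ge_atTop N] with n hn hnN i j
  have hsmall : ∀ j, influence (B n) j ≤ d := fun j =>
    (hB n).influence_le j hd0 (hN.trans_le (by exact_mod_cast hnN))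
  have hd1 : d ≤ 1 / 2 := min_le_left _ _
  have hd2 : d ≤ e / 2 := min_le_right _ _
  refine (hk n (fun j => ⟨hn j, by linarith [hsmall j]⟩) j i).trans ?_
  have h1 := hn j
  have h2 := hsmall j
  nlinarith

end DiscreteCube

theorem mainTheorem9 :
    ∃ a₀ : ℝ, 0 < a₀ ∧ ∃ K : ℝ, 0 < K ∧ ∀ a : ℝ, 0 < a → a < a₀ →
      (∃ A : ∀ n, Finset (DiscreteCube.Cube n), DiscreteCube.IsBallSeq (fun n => n) a A) ∧
      (∃ B' : ∀ n, Finset (DiscreteCube.Cube (n + 1)),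
        DiscreteCube.IsBallSeq (fun n => n + 1) (1 - a) B') ∧
      ∀ A : ∀ n, Finset (DiscreteCube.Cube n), DiscreteCube.IsBallSeq (fun n => n) a A →
      ∀ B : ∀ n, Finset (DiscreteCube.Cube n), (∀ n, B n = DiscreteCube.dual (A n)) →
        (∀ B' : ∀ n, Finset (DiscreteCube.Cube (n + 1)),
          DiscreteCube.IsBallSeq (fun n => n + 1) (1 - a) B' →
          ∀ᶠ n in atTop, DiscreteCube.TightWith K (DiscreteCube.orFirst (A n) 1) (B' n)) ∧
        (∃ (l : ℕ → ℕ) (C : ∀ n, Finset (DiscreteCube.Cube (l n))),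
          DiscreteCube.IsMatchingBalanced B l C) ∧
        (∀ (l : ℕ → ℕ) (C : ∀ n, Finset (DiscreteCube.Cube (l n))),
          DiscreteCube.IsMatchingBalanced B l C →
          ∀ᶠ n in atTop, DiscreteCube.TightWith K (DiscreteCube.orFirst (A n) (l n))
            (DiscreteCube.andFamily (B n) (C n))) := by
  open DiscreteCube in
  refine ⟨Real.exp (-8), Real.exp_pos _, 1600, by norm_num, fun a ha ha0 => ?_⟩
  have hL : 8 ≤ Real.log (1 / a) := by
    have := Real.log_le_log ha ha0.le
    rw [Real.log_exp] at this
    rw [one_div, Real.log_inv]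
    linarith
  have ha9 := le_eighth_of_log ha hL
  refine ⟨exists_isBallSeq ha (by linarith), ?_, ?_⟩
  · obtain ⟨F, hF, hlim⟩ := exists_isBallSeq (b := 1 - a) (by linarith) (by linarith)
    exact ⟨fun n => F (n + 1), fun n => hF (n + 1), hlim.comp (tendsto_add_atTop_nat 1)⟩
  intro A hA B hB
  obtain rfl : B = fun n => dual (A n) := funext hB
  obtain ⟨hball, hlim⟩ := hA
  have hA1 : ∀ᶠ n in atTop, 9 / 10 * a ≤ mu (A n) :=
    hlim.eventually_const_le (by linarith)
  have hA2 : ∀ᶠ n in atTop, mu (A n) ≤ 11 / 10 * a :=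
    hlim.eventually_le_const (by linarith)
  have hlarge : ∀ r : ℝ, ∀ᶠ n : ℕ in atTop, r < n := fun r =>
    tendsto_natCast_atTop_atTop.eventually_gt_atTop r
  refine ⟨?_, ?_, ?_⟩
  · rintro F ⟨hF, hFlim⟩
    have hF1 : ∀ᶠ n in atTop, mu (F n) ≤ 1 - 9 / 10 * a :=
      hFlim.eventually_le_const (by linarith)
    have hF2 : ∀ᶠ n in atTop, 1 - 11 / 10 * a ≤ mu (F n) :=
      hFlim.eventually_const_le (by linarith)
    filter_upwards [hA1, hA2, hF1, hF2, hlarge (Real.log (1 / a)), hlarge (4 / (a ^ 2) ^ 2)]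
      with n h1 h2 h3 h4 h5 h6
    exact tightWith_orFirst_ball ha hL (hball n) (hF n) h5.le h6 h1 h2 (by linarith) (by linarith)
  · refine exists_isMatchingBalanced (fun n => (hball n).dual) ?_
    filter_upwards [hA1, hA2, hlarge (Real.log (1 / a))] with n h1 h2 h3 j
    rw [influence_dual]
    have h4 := ((hball n).influence_bounds j ha hL h3.le (by linarith) (by linarith)).1
    refine lt_of_le_of_ne (influence_nonneg _ _) fun h => ?_
    rw [← h] at h4
    have : 0 < a ^ 2 * Real.log (1 / a) / 64 := by positivity
    simp at h4
    simp at this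
    linarith
  · rintro l C ⟨hC, hmatch⟩
    -- Matching with `ε = 1` is enough: influences of `C n` are at most twice those of the dual
    -- ball, hence at most `a ^ 2`.
    filter_upwards [hA1, hA2, hmatch 1 one_pos, hlarge (Real.log (1 / a)),
      hlarge (4 / (a ^ 2 / 2) ^ 2)] with n h1 h2 h3 h4 h5
    refine tightWith_orFirst_andFamily ha hL (hball n) (hC n).1 h4.le h1 h2 (hC n).2 fun i => ?_
    have hn : 0 < n := by
      have : (0 : ℝ) < n := by linarith
      exact_mod_cast this
    have h6 := (abs_le.1 (h3 i ⟨0, hn⟩)).2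
    have h7 := (hball n).dual.influence_le ⟨0, hn⟩ (show 0 < a ^ 2 / 2 by positivity) h5
    linarith
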